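/- Let $\mathbb K$ be a field of characteristic zero; all operads are symmetric operads over $\mathbb K$. For a $\mathbb K[S_2]$-module $V$ let $\mathcal F(V)$ be the free operad on $V$ placed in arity $2$. Its arity $3$ part $\mathcal F(V)(3)$ is the direct sum of three copies of $V\otimes V$, where the tensor $a\otimes b$ in the $k$-th copy ($k\in\mathbb Z/3$) is the operation $a\circ_k b:=a(b(x_k,x_{k+1}),x_{k+2})$. A binary quadratic operad is a quotient $\mathcal P=\mathcal F(V)/(R)$ by the operadic ideal generated by an $S_3$-submodule $R\subseteq\mathcal F(V)(3)$. The Manin black product of $\mathcal P=\mathcal F(V)/(R)$ and $\mathcal Q=\mathcal F(W)/(S)$ is $$\mathcal P\bullet\mathcal Q=\mathcal F(V\otimes W\otimes\mathrm{sgn}_{S_2})/(\Psi(R\otimes S)),$$ where $\Psi:\mathcal F(V)(3)\otimes\mathcal F(W)(3)\otimes\mathrm{sgn}_{S_3}\to\mathcal F(V\otimes W\otimes \mathrm{sgn}_{S_2})(3)$ sends $(a\circ_k b)\otimes(a'\circ_k b')$ to $(a\otimes a')\circ_k(b\otimes b')$, and $(a\circ_k b)\otimes(a'\circ_l b')$ to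 $0$ for $k\ne l$. Let $\mathrm{Lie}$, $\mathrm{Ass}$, $\mathrm{Com}$ be the binary quadratic operads of Lie, associative, and commutative associative algebras. Let * $\mathrm{LieAdm}$ be the operad of Lie-admissible algebras: one binary operation $\circ$ such that $[a,b]=a\circ b-b\circ a$ is a Lie bracket; * $\mathrm{AssAdm}$ be the operad of associative admissible algebras: two binary operations $\succ,\prec$ such that $a*b=a\succ b+a\prec b$ is associative; * $\mathrm{ComAdm}$ be the operad of commutative admissible algebras: one binary operation $\cdot$ such that $a\diamond b=a\cdot b+b\cdot a$ is (commutative and) associative. Then there are isomorphisms of operads $$\mathrm{LieAdm}\cong\mathrm{Lie}\bullet\mathrm{LieAdm},\qquad \mathrm{AssAdm}\cong\mathrm{Ass}\bullet\mathrm{LieAdm},\qquad \mathrm{ComAdm}\cong\mathrm{Com}\bullet\mathrm{LieAdm}.$$ -/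

import Mathlib

open scoped TensorProduct

universe u w

/-! ### Bijections used in the axioms of an operad -/

namespace SymOperad

/-- `A ⊔ (B ⊔ {∗}) ≃ (A ⊔ B) ⊔ {∗}`. -/
def sumOption (A B : Type) : A ⊕ Option B ≃ Option (A ⊕ B) where
  toFun
    | Sum.inl a => some (Sum.inl a)
    | Sum.inr (some b) => some (Sum.inr b)
    | Sum.inr none => none
  invFun
    | some (Sum.inl a) => Sum.inl a
    | some (Sum.inr b) => Sum.inr (some b)
    | none => Sum.inr none
  left_inv := by rintro (a | _ | b) <;> rfl
  right_inv := by rintro (_ | a | b) <;> rfl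

/-- `(A ⊔ {∗}) ⊔ B ≃ (A ⊔ B) ⊔ {∗}`. -/
def optionSum (A B : Type) : Option A ⊕ B ≃ Option (A ⊕ B) where
  toFun
    | Sum.inl (some a) => some (Sum.inl a)
    | Sum.inl none => none
    | Sum.inr b => some (Sum.inr b)
  invFun
    | some (Sum.inl a) => Sum.inl (some a)
    | some (Sum.inr b) => Sum.inr b
    | none => Sum.inl none
  left_inv := by rintro ((_ | a) | b) <;> rfl
  right_inv := by rintro (_ | a | b) <;> rfl

/-- The transposition of the two added points of `(A ⊔ {∗}) ⊔ {∗}`. -/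
def optionSwap (A : Type) : Option (Option A) ≃ Option (Option A) where
  toFun
    | none => some none
    | some none => none
    | some (some a) => some (some a)
  invFun
    | none => some none
    | some none => none
    | some (some a) => some (some a)
  left_inv := by rintro (_ | _ | a) <;> rfl
  right_inv := by rintro (_ | _ | a) <;> rfl

/-- `(A ⊔ B) ⊔ C ≃ (A ⊔ C) ⊔ B`. -/
def sumRightSwap (A B C : Type) : (A ⊕ B) ⊕ C ≃ (A ⊕ C) ⊕ B where
  toFun
    | Sum.inl (Sum.inl a) => Sum.inl (Sum.inl a)
    | Sum.inl (Sum.inr b) => Sum.inr b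
    | Sum.inr c => Sum.inl (Sum.inr c)
  invFun
    | Sum.inl (Sum.inl a) => Sum.inl (Sum.inl a)
    | Sum.inl (Sum.inr c) => Sum.inr c
    | Sum.inr b => Sum.inl (Sum.inr b)
  left_inv := by rintro ((a | b) | c) <;> rfl
  right_inv := by rintro ((a | b) | c) <;> rfl

end SymOperad

/-! ### Symmetric operads -/

/-- A symmetric operad over `K`, in the partial-composition form, with inputs labelled by
arbitrary finite sets: `obj A` is the space of operations with inputs labelled by `A` (so that
`obj (Fin n)` with the action `map` of the permutations of `Fin n` is the `S_n`-module of
operations of arity `n`), `map e` renames the input `a` to `e a`, `one` is the identity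
operation, and `comp x y` inserts the output of `y` into the input `none` of `x`. -/
structure SymOperad (K : Type u) [Field K] where
  obj : (A : Type) → [Finite A] → Type w
  [addCommGroup : ∀ (A : Type) [Finite A], AddCommGroup (obj A)]
  [module : ∀ (A : Type) [Finite A], Module K (obj A)]
  map : ∀ {A B : Type} [Finite A] [Finite B], (A ≃ B) → (obj A →ₗ[K] obj B)
  one : obj Unit
  comp : ∀ {A B : Type} [Finite A] [Finite B],
    obj (Option A) →ₗ[K] obj B →ₗ[K] obj (A ⊕ B)
  map_refl : ∀ {A : Type} [Finite A] (x : obj A), map (Equiv.refl A) x = x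
  map_trans : ∀ {A B C : Type} [Finite A] [Finite B] [Finite C] (e : A ≃ B) (f : B ≃ C)
    (x : obj A), map (e.trans f) x = map f (map e x)
  comp_map : ∀ {A A' B B' : Type} [Finite A] [Finite A'] [Finite B] [Finite B']
    (e : A ≃ A') (f : B ≃ B') (x : obj (Option A)) (y : obj B),
    comp (map (Equiv.optionCongr e) x) (map f y) = map (Equiv.sumCongr e f) (comp x y)
  one_comp : ∀ {B : Type} [Finite B] (y : obj B),
    map (Equiv.emptySum Empty B) (comp (map (Equiv.ofUnique Unit (Option Empty)) one) y) = y
  comp_one : ∀ {A : Type} [Finite A] (x : obj (Option A)),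
    map (Equiv.optionEquivSumPUnit A).symm (comp x one) = x
  /-- sequential composition -/
  comp_assoc : ∀ {A B C : Type} [Finite A] [Finite B] [Finite C]
    (x : obj (Option A)) (y : obj (Option B)) (z : obj C),
    map (Equiv.sumAssoc A B C) (comp (map (SymOperad.sumOption A B) (comp x y)) z)
      = comp x (comp y z)
  /-- parallel composition -/
  comp_comm : ∀ {A B C : Type} [Finite A] [Finite B] [Finite C]
    (x : obj (Option (Option A))) (y : obj B) (z : obj C),
    map (SymOperad.sumRightSwap A B C) (comp (map (SymOperad.optionSum A B) (comp x y)) z)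
      = comp (map (SymOperad.optionSum A C) (comp (map (SymOperad.optionSwap A) x) z)) y

attribute [instance] SymOperad.addCommGroup SymOperad.module

namespace SymOperad

variable {K : Type u} [Field K]

/-- An isomorphism of operads. -/
structure Iso (P Q : SymOperad.{u, w} K) where
  equiv : ∀ (A : Type) [Finite A], P.obj A ≃ₗ[K] Q.obj A
  equiv_map : ∀ {A B : Type} [Finite A] [Finite B] (e : A ≃ B) (x : P.obj A),
    equiv B (P.map e x) = Q.map e (equiv A x)
  equiv_one : equiv Unit P.one = Q.one
  equiv_comp : ∀ {A B : Type} [Finite A] [Finite B] (x : P.obj (Option A)) (y : P.obj B),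
    equiv (A ⊕ B) (P.comp x y) = Q.comp (equiv (Option A) x) (equiv B y)

/-- An operadic ideal. -/
structure Ideal (P : SymOperad.{u, w} K) where
  carrier : ∀ (A : Type) [Finite A], Submodule K (P.obj A)
  map_mem : ∀ {A B : Type} [Finite A] [Finite B] (e : A ≃ B) {x : P.obj A},
    x ∈ carrier A → P.map e x ∈ carrier B
  comp_mem_left : ∀ {A B : Type} [Finite A] [Finite B] {x : P.obj (Option A)} (y : P.obj B),
    x ∈ carrier (Option A) → P.comp x y ∈ carrier (A ⊕ B)
  comp_mem_right : ∀ {A B : Type} [Finite A] [Finite B] (x : P.obj (Option A)) {y : P.obj B},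
    y ∈ carrier B → P.comp x y ∈ carrier (A ⊕ B)

/-- The smallest operadic ideal that contains a given set of operations of arity `3`. -/
def Ideal.span (P : SymOperad.{u, w} K) (X : Set (P.obj (Fin 3))) : Ideal P where
  carrier A _ := ⨅ I : {I : Ideal P // X ⊆ I.carrier (Fin 3)}, I.1.carrier A
  map_mem e x hx := by
    rw [Submodule.mem_iInf] at hx ⊢
    exact fun I => I.1.map_mem e (hx I)
  comp_mem_left y hx := by
    rw [Submodule.mem_iInf] at hx ⊢
    exact fun I => I.1.comp_mem_left y (hx I)
  comp_mem_right x y hy := by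
    rw [Submodule.mem_iInf] at hy ⊢
    exact fun I => I.1.comp_mem_right x (hy I)

/-- The composition induced on the quotient by an operadic ideal. -/
def Ideal.quotientComp {P : SymOperad.{u, w} K} (I : Ideal P) (A B : Type) [Finite A] [Finite B] :
    (P.obj (Option A) ⧸ I.carrier (Option A)) →ₗ[K] (P.obj B ⧸ I.carrier B) →ₗ[K]
      (P.obj (A ⊕ B) ⧸ I.carrier (A ⊕ B)) :=
  Submodule.liftQ (I.carrier (Option A))
    { toFun := fun x => Submodule.mapQ (I.carrier B) (I.carrier (A ⊕ B)) (P.comp x)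
        (fun _ hy => I.comp_mem_right x hy)
      map_add' := fun x x' => by
        refine LinearMap.ext fun y => ?_
        obtain ⟨y, rfl⟩ := Submodule.Quotient.mk_surjective _ y
        rw [LinearMap.add_apply]
        simp only [Submodule.mapQ_apply, map_add, LinearMap.add_apply, Submodule.Quotient.mk_add]
      map_smul' := fun c x => by
        refine LinearMap.ext fun y => ?_
        obtain ⟨y, rfl⟩ := Submodule.Quotient.mk_surjective _ y
        rw [LinearMap.smul_apply]
        simp only [Submodule.mapQ_apply, map_smul, LinearMap.smul_apply,
          Submodule.Quotient.mk_smul, RingHom.id_apply] }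
    (fun x hx => by
      rw [LinearMap.mem_ker]
      refine LinearMap.ext fun y => ?_
      obtain ⟨y, rfl⟩ := Submodule.Quotient.mk_surjective _ y
      exact (Submodule.Quotient.mk_eq_zero _).2 (I.comp_mem_left y hx))

/-- The quotient of an operad by an operadic ideal. -/
def quotient (P : SymOperad.{u, w} K) (I : Ideal P) : SymOperad.{u, w} K where
  obj A _ := P.obj A ⧸ I.carrier A
  map {A B} _ _ e := Submodule.mapQ (I.carrier A) (I.carrier B) (P.map e)
    (fun _ hx => I.map_mem e hx)
  one := Submodule.Quotient.mk P.one
  comp {A B} _ _ := I.quotientComp A B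
  map_refl x := by
    obtain ⟨x, rfl⟩ := Submodule.Quotient.mk_surjective _ x
    exact congrArg Submodule.Quotient.mk (P.map_refl x)
  map_trans e f x := by
    obtain ⟨x, rfl⟩ := Submodule.Quotient.mk_surjective _ x
    exact congrArg Submodule.Quotient.mk (P.map_trans e f x)
  comp_map e f x y := by
    obtain ⟨x, rfl⟩ := Submodule.Quotient.mk_surjective _ x
    obtain ⟨y, rfl⟩ := Submodule.Quotient.mk_surjective _ y
    exact congrArg Submodule.Quotient.mk (P.comp_map e f x y)
  one_comp y := by
    obtain ⟨y, rfl⟩ := Submodule.Quotient.mk_surjective _ y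
    exact congrArg Submodule.Quotient.mk (P.one_comp y)
  comp_one x := by
    obtain ⟨x, rfl⟩ := Submodule.Quotient.mk_surjective _ x
    exact congrArg Submodule.Quotient.mk (P.comp_one x)
  comp_assoc x y z := by
    obtain ⟨x, rfl⟩ := Submodule.Quotient.mk_surjective _ x
    obtain ⟨y, rfl⟩ := Submodule.Quotient.mk_surjective _ y
    obtain ⟨z, rfl⟩ := Submodule.Quotient.mk_surjective _ z
    exact congrArg Submodule.Quotient.mk (P.comp_assoc x y z)
  comp_comm x y z := by
    obtain ⟨x, rfl⟩ := Submodule.Quotient.mk_surjective _ x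
    obtain ⟨y, rfl⟩ := Submodule.Quotient.mk_surjective _ y
    obtain ⟨z, rfl⟩ := Submodule.Quotient.mk_surjective _ z
    exact congrArg Submodule.Quotient.mk (P.comp_comm x y z)

/-- The bijection `{∗} ⊔ {0,1} ≃ {0,1,2}` with `∗ ↦ k + 2` and `i ↦ k + i` (modulo `3`). -/
noncomputable def treeLabel (k : Fin 3) : Unit ⊕ Fin 2 ≃ Fin 3 :=
  Equiv.ofBijective
    (fun s => match s with
      | Sum.inl _ => k + 2
      | Sum.inr i => k + Fin.castSucc i)
    (by revert k; decide)

/-- The bijection `{0,1} ≃ {1} ⊔ {∗}` with `0 ↦ ∗`. -/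
def firstInput : Fin 2 ≃ Option Unit where
  toFun := ![none, some ()]
  invFun
    | none => 0
    | some _ => 1
  left_inv := by decide
  right_inv := by rintro (_ | _) <;> rfl

/-- For binary operations `a`, `b`, the ternary operation
`a (b (x_k, x_{k+1}), x_{k+2})`, indices modulo `3`. -/
noncomputable def treeComp (P : SymOperad.{u, w} K) (k : Fin 3) :
    P.obj (Fin 2) →ₗ[K] P.obj (Fin 2) →ₗ[K] P.obj (Fin 3) :=
  ((P.comp (A := Unit) (B := Fin 2)).compr₂ (P.map (treeLabel k))).comp (P.map firstInput)

end SymOperad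

/-! ### The free operad on an `S₂`-module of binary operations -/

/-- Formal operadic expressions in binary operations `v : V`. -/
inductive FreeOperadExpr (K : Type u) (V : Type u) : (A : Type) → [Finite A] → Type (max 1 u)
  | gen (v : V) : FreeOperadExpr K V (Fin 2)
  | one : FreeOperadExpr K V Unit
  | map {A B : Type} [Finite A] [Finite B] (e : A ≃ B) (x : FreeOperadExpr K V A) :
      FreeOperadExpr K V B
  | comp {A B : Type} [Finite A] [Finite B] (x : FreeOperadExpr K V (Option A))
      (y : FreeOperadExpr K V B) : FreeOperadExpr K V (A ⊕ B)
  | zero {A : Type} [Finite A] : FreeOperadExpr K V A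
  | add {A : Type} [Finite A] (x y : FreeOperadExpr K V A) : FreeOperadExpr K V A
  | smul {A : Type} [Finite A] (c : K) (x : FreeOperadExpr K V A) : FreeOperadExpr K V A

open FreeOperadExpr in
/-- The congruence on formal expressions generated by the axioms of vector spaces, the axioms of
operads, the linearity of `V → F(V)(2)`, and the identification of the involution `τ` of `V`
(the action of the transposition of `S₂`) with the exchange of the two inputs. -/
inductive FreeOperadRel {K V : Type u} [Field K] [AddCommGroup V] [Module K V]
    (τ : V →ₗ[K] V) :
    {A : Type} → [Finite A] → FreeOperadExpr K V A → FreeOperadExpr K V A → Prop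
  -- equivalence relation
  | refl {A : Type} [Finite A] (x : FreeOperadExpr K V A) : FreeOperadRel τ x x
  | symm {A : Type} [Finite A] {x y : FreeOperadExpr K V A} :
      FreeOperadRel τ x y → FreeOperadRel τ y x
  | trans {A : Type} [Finite A] {x y z : FreeOperadExpr K V A} :
      FreeOperadRel τ x y → FreeOperadRel τ y z → FreeOperadRel τ x z
  -- compatibility with the operations
  | map_congr {A B : Type} [Finite A] [Finite B] (e : A ≃ B) {x y : FreeOperadExpr K V A} :
      FreeOperadRel τ x y → FreeOperadRel τ (map e x) (map e y)
  | comp_congr {A B : Type} [Finite A] [Finite B] {x x' : FreeOperadExpr K V (Option A)}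
      {y y' : FreeOperadExpr K V B} :
      FreeOperadRel τ x x' → FreeOperadRel τ y y' → FreeOperadRel τ (comp x y) (comp x' y')
  | add_congr {A : Type} [Finite A] {x x' y y' : FreeOperadExpr K V A} :
      FreeOperadRel τ x x' → FreeOperadRel τ y y' → FreeOperadRel τ (add x y) (add x' y')
  | smul_congr {A : Type} [Finite A] (c : K) {x x' : FreeOperadExpr K V A} :
      FreeOperadRel τ x x' → FreeOperadRel τ (smul c x) (smul c x')
  -- vector space axioms
  | add_assoc {A : Type} [Finite A] (x y z : FreeOperadExpr K V A) :
      FreeOperadRel τ (add (add x y) z) (add x (add y z))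
  | add_comm {A : Type} [Finite A] (x y : FreeOperadExpr K V A) :
      FreeOperadRel τ (add x y) (add y x)
  | zero_add {A : Type} [Finite A] (x : FreeOperadExpr K V A) :
      FreeOperadRel τ (add zero x) x
  | zero_smul {A : Type} [Finite A] (x : FreeOperadExpr K V A) :
      FreeOperadRel τ (smul 0 x) zero
  | one_smul {A : Type} [Finite A] (x : FreeOperadExpr K V A) :
      FreeOperadRel τ (smul 1 x) x
  | mul_smul {A : Type} [Finite A] (c d : K) (x : FreeOperadExpr K V A) :
      FreeOperadRel τ (smul (c * d) x) (smul c (smul d x))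
  | smul_add {A : Type} [Finite A] (c : K) (x y : FreeOperadExpr K V A) :
      FreeOperadRel τ (smul c (add x y)) (add (smul c x) (smul c y))
  | add_smul {A : Type} [Finite A] (c d : K) (x : FreeOperadExpr K V A) :
      FreeOperadRel τ (smul (c + d) x) (add (smul c x) (smul d x))
  -- linearity of renaming and of composition
  | map_add {A B : Type} [Finite A] [Finite B] (e : A ≃ B) (x y : FreeOperadExpr K V A) :
      FreeOperadRel τ (map e (add x y)) (add (map e x) (map e y))
  | map_smul {A B : Type} [Finite A] [Finite B] (e : A ≃ B) (c : K)
      (x : FreeOperadExpr K V A) :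
      FreeOperadRel τ (map e (smul c x)) (smul c (map e x))
  | add_comp {A B : Type} [Finite A] [Finite B] (x x' : FreeOperadExpr K V (Option A))
      (y : FreeOperadExpr K V B) :
      FreeOperadRel τ (comp (add x x') y) (add (comp x y) (comp x' y))
  | smul_comp {A B : Type} [Finite A] [Finite B] (c : K) (x : FreeOperadExpr K V (Option A))
      (y : FreeOperadExpr K V B) :
      FreeOperadRel τ (comp (smul c x) y) (smul c (comp x y))
  | comp_add {A B : Type} [Finite A] [Finite B] (x : FreeOperadExpr K V (Option A))
      (y y' : FreeOperadExpr K V B) :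
      FreeOperadRel τ (comp x (add y y')) (add (comp x y) (comp x y'))
  | comp_smul {A B : Type} [Finite A] [Finite B] (c : K) (x : FreeOperadExpr K V (Option A))
      (y : FreeOperadExpr K V B) :
      FreeOperadRel τ (comp x (smul c y)) (smul c (comp x y))
  -- operad axioms
  | map_refl {A : Type} [Finite A] (x : FreeOperadExpr K V A) :
      FreeOperadRel τ (map (Equiv.refl A) x) x
  | map_trans {A B C : Type} [Finite A] [Finite B] [Finite C] (e : A ≃ B) (f : B ≃ C)
      (x : FreeOperadExpr K V A) :
      FreeOperadRel τ (map (e.trans f) x) (map f (map e x))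
  | comp_map {A A' B B' : Type} [Finite A] [Finite A'] [Finite B] [Finite B']
      (e : A ≃ A') (f : B ≃ B') (x : FreeOperadExpr K V (Option A)) (y : FreeOperadExpr K V B) :
      FreeOperadRel τ (comp (map (Equiv.optionCongr e) x) (map f y))
        (map (Equiv.sumCongr e f) (comp x y))
  | one_comp {B : Type} [Finite B] (y : FreeOperadExpr K V B) :
      FreeOperadRel τ (map (Equiv.emptySum Empty B)
        (comp (map (Equiv.ofUnique Unit (Option Empty)) one) y)) y
  | comp_one {A : Type} [Finite A] (x : FreeOperadExpr K V (Option A)) :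
      FreeOperadRel τ (map (Equiv.optionEquivSumPUnit A).symm (comp x one)) x
  | comp_assoc {A B C : Type} [Finite A] [Finite B] [Finite C]
      (x : FreeOperadExpr K V (Option A)) (y : FreeOperadExpr K V (Option B))
      (z : FreeOperadExpr K V C) :
      FreeOperadRel τ
        (map (Equiv.sumAssoc A B C) (comp (map (SymOperad.sumOption A B) (comp x y)) z))
        (comp x (comp y z))
  | comp_comm {A B C : Type} [Finite A] [Finite B] [Finite C]
      (x : FreeOperadExpr K V (Option (Option A))) (y : FreeOperadExpr K V B)
      (z : FreeOperadExpr K V C) :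
      FreeOperadRel τ
        (map (SymOperad.sumRightSwap A B C)
          (comp (map (SymOperad.optionSum A B) (comp x y)) z))
        (comp (map (SymOperad.optionSum A C) (comp (map (SymOperad.optionSwap A) x) z)) y)
  -- generators
  | gen_add (v v' : V) : FreeOperadRel τ (gen (v + v')) (add (gen v) (gen v'))
  | gen_smul (c : K) (v : V) : FreeOperadRel τ (gen (c • v)) (smul c (gen v))
  | gen_swap (v : V) : FreeOperadRel τ (gen (τ v)) (map (Equiv.swap 0 1) (gen v))

namespace FreeOperad

variable {K V : Type u} [Field K] [AddCommGroup V] [Module K V] (τ : V →ₗ[K] V)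

/-- The congruence as a setoid. -/
def exprSetoid (A : Type) [Finite A] : Setoid (FreeOperadExpr K V A) where
  r := FreeOperadRel τ
  iseqv := ⟨.refl, .symm, .trans⟩

/-- The operations of the free operad with inputs labelled by `A`. -/
def Obj (A : Type) [Finite A] : Type (max 1 u) := Quotient (exprSetoid τ A)

instance (A : Type) [Finite A] : Zero (Obj τ A) := ⟨Quotient.mk (exprSetoid τ A) .zero⟩

instance (A : Type) [Finite A] : Add (Obj τ A) :=
  ⟨Quotient.map₂ .add (fun _ _ h _ _ h' => .add_congr h h')⟩

instance (A : Type) [Finite A] : Neg (Obj τ A) :=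
  ⟨Quotient.map (.smul (-1)) (fun _ _ h => .smul_congr _ h)⟩

instance (A : Type) [Finite A] : AddCommGroup (Obj τ A) where
  add_assoc := by
    rintro ⟨x⟩ ⟨y⟩ ⟨z⟩
    exact Quotient.sound (.add_assoc x y z)
  zero_add := by
    rintro ⟨x⟩
    exact Quotient.sound (.zero_add x)
  add_zero := by
    rintro ⟨x⟩
    exact Quotient.sound ((FreeOperadRel.add_comm _ _).trans (.zero_add x))
  add_comm := by
    rintro ⟨x⟩ ⟨y⟩
    exact Quotient.sound (.add_comm x y)
  neg_add_cancel := by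
    rintro ⟨x⟩
    refine Quotient.sound (s := exprSetoid τ A) ?_
    have h1 : FreeOperadRel τ (.add (.smul (-1) x) x) (.add (.smul (-1) x) (.smul 1 x)) :=
      .add_congr (.refl _) (.symm (.one_smul x))
    have h2 : FreeOperadRel τ (.smul (-1 + 1) x) (.add (.smul (-1) x) (.smul 1 x)) :=
      .add_smul (-1) 1 x
    rw [neg_add_cancel] at h2
    exact h1.trans (h2.symm.trans (.zero_smul x))
  nsmul := nsmulRec
  zsmul := zsmulRec

instance (A : Type) [Finite A] : Module K (Obj τ A) where
  smul c := Quotient.map (.smul c) (fun _ _ h => .smul_congr c h)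
  one_smul := by
    rintro ⟨x⟩
    exact Quotient.sound (.one_smul x)
  mul_smul := by
    rintro c d ⟨x⟩
    exact Quotient.sound (.mul_smul c d x)
  smul_add := by
    rintro c ⟨x⟩ ⟨y⟩
    exact Quotient.sound (.smul_add c x y)
  add_smul := by
    rintro c d ⟨x⟩
    exact Quotient.sound (.add_smul c d x)
  zero_smul := by
    rintro ⟨x⟩
    exact Quotient.sound (.zero_smul x)
  smul_zero := by
    intro c
    refine Quotient.sound (s := exprSetoid τ A) ?_
    have h : FreeOperadRel τ (A := A) (.smul (c * 0) .zero) (.smul c (.smul 0 .zero)) :=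
      .mul_smul c 0 .zero
    rw [mul_zero] at h
    exact (FreeOperadRel.smul_congr c (.symm (.zero_smul .zero))).trans
      (h.symm.trans (.zero_smul _))

end FreeOperad

/-- The free operad `F(V)` on a vector space `V` of binary operations, on which the transposition
of `S₂` acts by `τ`. -/
def FreeOperad {K V : Type u} [Field K] [AddCommGroup V] [Module K V] (τ : V →ₗ[K] V) :
    SymOperad.{u, max 1 u} K where
  obj A _ := FreeOperad.Obj τ A
  map e :=
    { toFun := Quotient.map (.map e) (fun _ _ h => .map_congr e h)
      map_add' := by
        rintro ⟨x⟩ ⟨y⟩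
        exact Quotient.sound (.map_add e x y)
      map_smul' := by
        rintro c ⟨x⟩
        exact Quotient.sound (.map_smul e c x) }
  one := Quotient.mk _ .one
  comp := LinearMap.mk₂ K
    (Quotient.map₂ .comp (fun _ _ h _ _ h' => .comp_congr h h'))
    (by
      rintro ⟨x⟩ ⟨x'⟩ ⟨y⟩
      exact Quotient.sound (.add_comp x x' y))
    (by
      rintro c ⟨x⟩ ⟨y⟩
      exact Quotient.sound (.smul_comp c x y))
    (by
      rintro ⟨x⟩ ⟨y⟩ ⟨y'⟩
      exact Quotient.sound (.comp_add x y y'))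
    (by
      rintro c ⟨x⟩ ⟨y⟩
      exact Quotient.sound (.comp_smul c x y))
  map_refl := by
    rintro A _ ⟨x⟩
    exact Quotient.sound (.map_refl x)
  map_trans := by
    rintro A B C _ _ _ e f ⟨x⟩
    exact Quotient.sound (.map_trans e f x)
  comp_map := by
    rintro A A' B B' _ _ _ _ e f ⟨x⟩ ⟨y⟩
    exact Quotient.sound (.comp_map e f x y)
  one_comp := by
    rintro B _ ⟨y⟩
    exact Quotient.sound (.one_comp y)
  comp_one := by
    rintro A _ ⟨x⟩
    exact Quotient.sound (.comp_one x)
  comp_assoc := by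
    rintro A B C _ _ _ ⟨x⟩ ⟨y⟩ ⟨z⟩
    exact Quotient.sound (.comp_assoc x y z)
  comp_comm := by
    rintro A B C _ _ _ ⟨x⟩ ⟨y⟩ ⟨z⟩
    exact Quotient.sound (.comp_comm x y z)

/-- The inclusion `V → F(V)(2)` of the generators. -/
def FreeOperad.gen {K V : Type u} [Field K] [AddCommGroup V] [Module K V] (τ : V →ₗ[K] V) :
    V →ₗ[K] (FreeOperad τ).obj (Fin 2) where
  toFun v := Quotient.mk (FreeOperad.exprSetoid τ (Fin 2)) (.gen v)
  map_add' v v' := Quotient.sound (.gen_add v v')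
  map_smul' c v := Quotient.sound (.gen_smul c v)

/-! ### Binary quadratic operads

For an `S₂`-module `V` the space `F(V)(3)` is the direct sum of three copies of `V ⊗ V`, one for
each way to put three inputs on a binary tree with two vertices. We write its elements as
functions `t : Fin 3 → V ⊗ V`; the tensor `a ⊗ b` in place `k` is the operation
`a (b (x_k, x_{k+1}), x_{k+2})`, indices modulo `3`. -/

section Quadratic

variable {K V : Type u} [Field K] [AddCommGroup V] [Module K V]

/-- The cyclic renaming `x₀ ↦ x₁ ↦ x₂ ↦ x₀` of the inputs. -/
def treeCycle : (Fin 3 → V ⊗[K] V) →ₗ[K] (Fin 3 → V ⊗[K] V) :=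
  LinearMap.funLeft K (V ⊗[K] V) (fun k : Fin 3 => k - 1)

/-- The exchange `x₀ ↔ x₁` of inputs. It turns `a (b (x₀, x₁), x₂)` into `a (b (x₁, x₀), x₂)`,
and it turns `a (b (x₁, x₂), x₀)` into `a (b (x₀, x₂), x₁)`. -/
def treeSwap (τ : V →ₗ[K] V) : (Fin 3 → V ⊗[K] V) →ₗ[K] (Fin 3 → V ⊗[K] V) :=
  LinearMap.pi fun k => (TensorProduct.map LinearMap.id τ).comp (LinearMap.proj (-k))

/-- The inclusion of `Fin 3 → V ⊗ V` as the arity `3` part of the free operad. -/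
noncomputable def treeEval (τ : V →ₗ[K] V) :
    (Fin 3 → V ⊗[K] V) →ₗ[K] (FreeOperad τ).obj (Fin 3) :=
  LinearMap.lsum K (fun _ : Fin 3 => V ⊗[K] V) K fun k =>
    TensorProduct.lift
      (((FreeOperad τ).treeComp k).compl₁₂ (FreeOperad.gen τ) (FreeOperad.gen τ))

/-- `a (b (x₀, x₁), x₂)` -/
def leftTree (a b : V) : Fin 3 → V ⊗[K] V := Pi.single 0 (a ⊗ₜ[K] b)

/-- `a (x₀, b (x₁, x₂))` -/
def rightTree (τ : V →ₗ[K] V) (a b : V) : Fin 3 → V ⊗[K] V := Pi.single 1 (τ a ⊗ₜ[K] b)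

/-- The associator `a (a (x₀, x₁), x₂) - a (x₀, a (x₁, x₂))`. -/
def associatorTree (τ : V →ₗ[K] V) (a : V) : Fin 3 → V ⊗[K] V :=
  leftTree a a - rightTree τ a a

/-- The Jacobiator `b (b (x₀, x₁), x₂) + b (b (x₁, x₂), x₀) + b (b (x₂, x₀), x₁)`. -/
def jacobiatorTree (b : V) : Fin 3 → V ⊗[K] V := fun _ => b ⊗ₜ[K] b

end Quadratic

/-- Binary quadratic data `(V, R)`: an `S₂`-module `V`, given by the action `τ` of the
transposition, and an `S₃`-submodule `R` of `F(V)(3)`. -/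
structure BinaryQuadraticData (K : Type u) [Field K] where
  V : Type u
  [addCommGroup : AddCommGroup V]
  [module : Module K V]
  τ : V →ₗ[K] V
  τ_τ : ∀ v, τ (τ v) = v
  R : Submodule K (Fin 3 → V ⊗[K] V)
  treeCycle_mem : ∀ r ∈ R, treeCycle r ∈ R
  treeSwap_mem : ∀ r ∈ R, treeSwap τ r ∈ R

attribute [instance] BinaryQuadraticData.addCommGroup BinaryQuadraticData.module

namespace BinaryQuadraticData

variable {K : Type u} [Field K]

/-- The binary quadratic operad `F(V)/(R)`. -/
noncomputable def operad (P : BinaryQuadraticData K) : SymOperad.{u, max 1 u} K :=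
  (FreeOperad P.τ).quotient (SymOperad.Ideal.span (FreeOperad P.τ) (treeEval P.τ '' P.R))

/-- The data `(V, R)` where `R` is the `S₃`-submodule generated by a set `X`. -/
def ofRelators (V : Type u) [AddCommGroup V] [Module K V] (τ : V →ₗ[K] V)
    (hτ : ∀ v, τ (τ v) = v) (X : Set (Fin 3 → V ⊗[K] V)) : BinaryQuadraticData K where
  V := V
  τ := τ
  τ_τ := hτ
  R := sInf {S | X ⊆ S ∧ (∀ r ∈ S, treeCycle r ∈ S) ∧ ∀ r ∈ S, treeSwap τ r ∈ S}
  treeCycle_mem r hr := by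
    rw [Submodule.mem_sInf] at hr ⊢
    exact fun S hS => hS.2.1 r (hr S hS)
  treeSwap_mem r hr := by
    rw [Submodule.mem_sInf] at hr ⊢
    exact fun S hS => hS.2.2 r (hr S hS)

/-! ### The Manin black product -/

/-- The map `Ψ : F(V)(3) ⊗ F(W)(3) ⊗ sgn → F(V ⊗ W ⊗ sgn)(3)`: trees of the same shape are
multiplied vertex by vertex, and the product of trees of different shapes is `0`. -/
noncomputable def blackMap {V W : Type u} [AddCommGroup V] [Module K V] [AddCommGroup W]
    [Module K W] (r : Fin 3 → V ⊗[K] V) (s : Fin 3 → W ⊗[K] W) :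
    Fin 3 → (V ⊗[K] W) ⊗[K] (V ⊗[K] W) :=
  fun k => TensorProduct.tensorTensorTensorComm K V V W W (r k ⊗ₜ[K] s k)

/-- The action of the transposition on `V ⊗ W ⊗ sgn`. -/
noncomputable def blackSwap {V W : Type u} [AddCommGroup V] [Module K V] [AddCommGroup W]
    [Module K W] (τ : V →ₗ[K] V) (τ' : W →ₗ[K] W) : V ⊗[K] W →ₗ[K] V ⊗[K] W :=
  -TensorProduct.map τ τ'

theorem treeCycle_blackMap {V W : Type u} [AddCommGroup V] [Module K V] [AddCommGroup W]
    [Module K W] (r : Fin 3 → V ⊗[K] V) (s : Fin 3 → W ⊗[K] W) :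
    treeCycle (blackMap r s) = blackMap (treeCycle r) (treeCycle s) := rfl

theorem treeSwap_blackMap {V W : Type u} [AddCommGroup V] [Module K V] [AddCommGroup W]
    [Module K W] (τ : V →ₗ[K] V) (τ' : W →ₗ[K] W)
    (r : Fin 3 → V ⊗[K] V) (s : Fin 3 → W ⊗[K] W) :
    treeSwap (blackSwap τ τ') (blackMap r s)
      = -blackMap (treeSwap τ r) (treeSwap τ' s) := by
  funext k
  simp only [treeSwap, blackMap, LinearMap.pi_apply, LinearMap.comp_apply, LinearMap.proj_apply,
    Pi.neg_apply]
  generalize r (-k) = x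
  generalize s (-k) = y
  induction x with
  | zero => simp
  | add x x' hx hx' =>
    simp only [TensorProduct.add_tmul, map_add, hx, hx', neg_add]
  | tmul a b =>
    induction y with
    | zero => simp
    | add y y' hy hy' =>
      simp only [TensorProduct.tmul_add, map_add, hy, hy', neg_add]
    | tmul c d => simp [blackSwap, TensorProduct.tmul_neg]

/-- The black product `P • Q = F(V ⊗ W ⊗ sgn)/(Ψ(R ⊗ S))` of `P = F(V)/(R)` and
`Q = F(W)/(S)`. -/
noncomputable def black (P Q : BinaryQuadraticData K) : BinaryQuadraticData K where
  V := P.V ⊗[K] Q.V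
  τ := blackSwap P.τ Q.τ
  τ_τ v := by
    induction v with
    | zero => simp
    | add x y hx hy => rw [map_add, map_add, hx, hy]
    | tmul a b => simp [blackSwap, P.τ_τ, Q.τ_τ]
  R := Submodule.span K {t | ∃ r ∈ P.R, ∃ s ∈ Q.R, t = blackMap r s}
  treeCycle_mem t ht := by
    induction ht using Submodule.span_induction with
    | mem t ht =>
      obtain ⟨r, hr, s, hs, rfl⟩ := ht
      exact Submodule.subset_span
        ⟨_, P.treeCycle_mem r hr, _, Q.treeCycle_mem s hs, treeCycle_blackMap r s⟩
    | zero => simp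
    | add x y _ _ hx hy => rw [map_add]; exact Submodule.add_mem _ hx hy
    | smul c x _ hx => rw [map_smul]; exact Submodule.smul_mem _ c hx
  treeSwap_mem t ht := by
    induction ht using Submodule.span_induction with
    | mem t ht =>
      obtain ⟨r, hr, s, hs, rfl⟩ := ht
      rw [treeSwap_blackMap]
      exact Submodule.neg_mem _ (Submodule.subset_span
        ⟨_, P.treeSwap_mem r hr, _, Q.treeSwap_mem s hs, rfl⟩)
    | zero => simp
    | add x y _ _ hx hy => rw [map_add]; exact Submodule.add_mem _ hx hy
    | smul c x _ hx => rw [map_smul]; exact Submodule.smul_mem _ c hx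

/-! ### The operads of the statement -/

variable (K)

/-- The regular representation of `S₂`: one binary operation `(1, 0)` without symmetry, and its
opposite operation `(0, 1)`. -/
def regSwap : K × K →ₗ[K] K × K := (LinearEquiv.prodComm K K K).toLinearMap

/-- Commutative associative algebras: one symmetric operation, which is associative. -/
def Com : BinaryQuadraticData K :=
  ofRelators K LinearMap.id (fun _ => rfl) {associatorTree LinearMap.id 1}

/-- Lie algebras: one antisymmetric operation, which satisfies the Jacobi identity. -/
def Lie : BinaryQuadraticData K :=
  ofRelators K (-LinearMap.id) (fun v => neg_neg v) {jacobiatorTree 1}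

/-- Associative algebras: one operation, which is associative. -/
def Ass : BinaryQuadraticData K :=
  ofRelators (K × K) (regSwap K) (fun _ => rfl) {associatorTree (regSwap K) (1, 0)}

/-- Lie-admissible algebras: one operation `a ∘ b`, such that `a ∘ b - b ∘ a` is a Lie bracket. -/
def LieAdm : BinaryQuadraticData K :=
  ofRelators (K × K) (regSwap K) (fun _ => rfl)
    {jacobiatorTree ((1, 0) - regSwap K (1, 0))}

/-- Com.-admissible algebras: one operation `a · b`, such that `a · b + b · a` is associative
(it is commutative anyway). -/
def ComAdm : BinaryQuadraticData K :=
  ofRelators (K × K) (regSwap K) (fun _ => rfl)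
    {associatorTree (regSwap K) ((1, 0) + regSwap K (1, 0))}

/-- Ass.-admissible algebras: two operations `≻ = ((1, 0), 0)` and `≺ = (0, (1, 0))` without
symmetry, such that `a ≻ b + a ≺ b` is associative. -/
def AssAdm : BinaryQuadraticData K :=
  ofRelators ((K × K) × (K × K)) ((regSwap K).prodMap (regSwap K)) (fun _ => rfl)
    {associatorTree ((regSwap K).prodMap (regSwap K)) (((1, 0), 0) + (0, (1, 0)))}

end BinaryQuadraticData

/-!
An isomorphism of binary quadratic data, that is, an `S₂`-equivariant isomorphism of the spaces
of generators which matches the two spaces of relators, induces an isomorphism of the operads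
they present: the free operad is functorial, and an isomorphism that matches generating sets of
two ideals descends to the quotients (`BinaryQuadraticData.nonempty_iso_operad`). So it suffices
to compare quadratic data.

The relators of `LieAdm` form a line, spanned by the Jacobiator `J` of the bracket
`b = μ - τ μ`, on which `S₃` acts by the sign character. Twisting by the sign, `r ↦ Ψ (r ⊗ J)` is
therefore `S₃`-equivariant. Hence, if one relator `x` generates the relators of `P`, then
`Ψ (x ⊗ J)` generates those of `P • LieAdm`, whatever `P` is (`IsGenerator.black_LieAdm`). Since
`τ b = -b`, the associator of an operation `a` goes to the associator of `a ⊗ b`, and its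
Jacobiator to the Jacobiator of `a ⊗ b`. It remains to identify the generators in each case so that
the bracket, the sum `≻ + ≺`, or the symmetrized product corresponds to `a ⊗ b`.
-/

/-! ### Isomorphisms of operads and of their quotients -/

namespace SymOperad

variable {K : Type u} [Field K] {P Q : SymOperad.{u, w} K}

/-- The inverse of an isomorphism of operads. -/
def Iso.symm (f : Iso P Q) : Iso Q P where
  equiv A _ := (f.equiv A).symm
  equiv_map e x := by
    rw [LinearEquiv.symm_apply_eq, f.equiv_map, LinearEquiv.apply_symm_apply]
  equiv_one := by rw [LinearEquiv.symm_apply_eq, f.equiv_one]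
  equiv_comp x y := by
    rw [LinearEquiv.symm_apply_eq, f.equiv_comp, LinearEquiv.apply_symm_apply,
      LinearEquiv.apply_symm_apply]

/-- The preimage of an operadic ideal under an isomorphism of operads. -/
def Ideal.comap (f : Iso P Q) (J : Ideal Q) : Ideal P where
  carrier A _ := (J.carrier A).comap (f.equiv A).toLinearMap
  map_mem e x hx := by
    simp only [Submodule.mem_comap, LinearEquiv.coe_coe, f.equiv_map] at hx ⊢
    exact J.map_mem e hx
  comp_mem_left y hx := by
    simp only [Submodule.mem_comap, LinearEquiv.coe_coe, f.equiv_comp] at hx ⊢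
    exact J.comp_mem_left _ hx
  comp_mem_right x y hy := by
    simp only [Submodule.mem_comap, LinearEquiv.coe_coe, f.equiv_comp] at hy ⊢
    exact J.comp_mem_right _ hy

theorem Ideal.subset_span (X : Set (P.obj (Fin 3))) : X ⊆ (Ideal.span P X).carrier (Fin 3) :=
  fun _ hx => (Submodule.mem_iInf _).2 fun I => I.2 hx

theorem Ideal.span_le {X : Set (P.obj (Fin 3))} {I : Ideal P} (h : X ⊆ I.carrier (Fin 3))
    (A : Type) [Finite A] : (Ideal.span P X).carrier A ≤ I.carrier A :=
  iInf_le (fun I : {I : Ideal P // X ⊆ I.carrier (Fin 3)} => I.1.carrier A) ⟨I, h⟩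

theorem Ideal.span_le_comap_span (f : Iso P Q) {X : Set (P.obj (Fin 3))}
    {Y : Set (Q.obj (Fin 3))} (h : ∀ x ∈ X, f.equiv (Fin 3) x ∈ Y) (A : Type) [Finite A] :
    (Ideal.span P X).carrier A ≤
      ((Ideal.span Q Y).carrier A).comap (f.equiv A).toLinearMap :=
  Ideal.span_le (I := (Ideal.span Q Y).comap f) (fun x hx => Ideal.subset_span Y (h x hx)) A

/-- An isomorphism of operads that matches two ideals descends to the quotients. -/
def Iso.quotient (f : Iso P Q) (I : Ideal P) (J : Ideal Q)
    (h : ∀ (A : Type) [Finite A],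
      I.carrier A ≤ (J.carrier A).comap (f.equiv A).toLinearMap)
    (h' : ∀ (A : Type) [Finite A],
      J.carrier A ≤ (I.carrier A).comap (f.equiv A).symm.toLinearMap) :
    Iso (P.quotient I) (Q.quotient J) where
  equiv A _ := LinearEquiv.ofLinearMap
    (Submodule.mapQ (I.carrier A) (J.carrier A) (f.equiv A).toLinearMap (h A))
    (Submodule.mapQ (J.carrier A) (I.carrier A) (f.equiv A).symm.toLinearMap (h' A))
    (by
      refine LinearMap.ext fun y => ?_
      obtain ⟨y, rfl⟩ := Submodule.Quotient.mk_surjective _ y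
      exact congrArg Submodule.Quotient.mk ((f.equiv A).apply_symm_apply y))
    (by
      refine LinearMap.ext fun x => ?_
      obtain ⟨x, rfl⟩ := Submodule.Quotient.mk_surjective _ x
      exact congrArg Submodule.Quotient.mk ((f.equiv A).symm_apply_apply x))
  equiv_map e x := by
    obtain ⟨x, rfl⟩ := Submodule.Quotient.mk_surjective _ x
    exact congrArg Submodule.Quotient.mk (f.equiv_map e x)
  equiv_one := congrArg Submodule.Quotient.mk f.equiv_one
  equiv_comp x y := by
    obtain ⟨x, rfl⟩ := Submodule.Quotient.mk_surjective _ x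
    obtain ⟨y, rfl⟩ := Submodule.Quotient.mk_surjective _ y
    exact congrArg Submodule.Quotient.mk (f.equiv_comp x y)

end SymOperad

/-! ### Functoriality of the free operad -/

/-- Replacement of the generators of a formal operadic expression along `f : V → W`. -/
def FreeOperadExpr.mapGen {K V W : Type u} (f : V → W) :
    {A : Type} → [Finite A] → FreeOperadExpr K V A → FreeOperadExpr K W A
  | _, _, gen v => gen (f v)
  | _, _, one => one
  | _, _, map e x => map e (x.mapGen f)
  | _, _, comp x y => comp (x.mapGen f) (y.mapGen f)
  | _, _, zero => zero
  | _, _, add x y => add (x.mapGen f) (y.mapGen f)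
  | _, _, smul c x => smul c (x.mapGen f)

theorem FreeOperadExpr.mapGen_mapGen {K V W : Type u} {f : V → W} {g : W → V}
    (h : ∀ v, g (f v) = v) {A : Type} [Finite A] (x : FreeOperadExpr K V A) : (x.mapGen f).mapGen g = x := by
  induction x <;> simp_all [mapGen]

section Functoriality

variable {K V W : Type u} [Field K] [AddCommGroup V] [Module K V] [AddCommGroup W] [Module K W]

theorem FreeOperadRel.mapGen {τ : V →ₗ[K] V} {τ' : W →ₗ[K] W} (f : V →ₗ[K] W)
    (hf : ∀ v, f (τ v) = τ' (f v)) {A : Type} [Finite A] {x y : FreeOperadExpr K V A}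
    (h : FreeOperadRel τ x y) : FreeOperadRel τ' (x.mapGen f) (y.mapGen f) := by
  induction h with
  | refl => exact .refl _
  | symm _ ih => exact ih.symm
  | trans _ _ ih ih' => exact ih.trans ih'
  | map_congr e _ ih => exact .map_congr e ih
  | comp_congr _ _ ih ih' => exact .comp_congr ih ih'
  | add_congr _ _ ih ih' => exact .add_congr ih ih'
  | smul_congr c _ ih => exact .smul_congr c ih
  | add_assoc => exact .add_assoc _ _ _
  | add_comm => exact .add_comm _ _
  | zero_add => exact .zero_add _
  | zero_smul => exact .zero_smul _
  | one_smul => exact .one_smul _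
  | mul_smul => exact .mul_smul _ _ _
  | smul_add => exact .smul_add _ _ _
  | add_smul => exact .add_smul _ _ _
  | map_add => exact .map_add _ _ _
  | map_smul => exact .map_smul _ _ _
  | add_comp => exact .add_comp _ _ _
  | smul_comp => exact .smul_comp _ _ _
  | comp_add => exact .comp_add _ _ _
  | comp_smul => exact .comp_smul _ _ _
  | map_refl => exact .map_refl _
  | map_trans => exact .map_trans _ _ _
  | comp_map => exact .comp_map _ _ _ _
  | one_comp => exact .one_comp _
  | comp_one => exact .comp_one _
  | comp_assoc => exact .comp_assoc _ _ _
  | comp_comm => exact .comp_comm _ _ _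
  | gen_add v v' =>
    simp only [FreeOperadExpr.mapGen, _root_.map_add]
    exact .gen_add _ _
  | gen_smul c v =>
    simp only [FreeOperadExpr.mapGen, _root_.map_smul]
    exact .gen_smul _ _
  | gen_swap v =>
    simp only [FreeOperadExpr.mapGen, hf]
    exact .gen_swap _

/-- The isomorphism of free operads induced by an isomorphism of `S₂`-modules. -/
def FreeOperad.congr {τ : V →ₗ[K] V} {τ' : W →ₗ[K] W} (φ : V ≃ₗ[K] W)
    (hφ : ∀ v, φ (τ v) = τ' (φ v)) (hφ' : ∀ w, φ.symm (τ' w) = τ (φ.symm w)) :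
    SymOperad.Iso (FreeOperad τ) (FreeOperad τ') where
  equiv A _ :=
    { toFun := Quotient.map (FreeOperadExpr.mapGen φ) (fun _ _ h => h.mapGen φ.toLinearMap hφ)
      invFun := Quotient.map (FreeOperadExpr.mapGen φ.symm)
        (fun _ _ h => h.mapGen φ.symm.toLinearMap hφ')
      map_add' := by rintro ⟨x⟩ ⟨y⟩; rfl
      map_smul' := by rintro c ⟨x⟩; rfl
      left_inv := by
        rintro ⟨x⟩
        exact congrArg (Quotient.mk _) (FreeOperadExpr.mapGen_mapGen φ.symm_apply_apply x)
      right_inv := by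
        rintro ⟨x⟩
        exact congrArg (Quotient.mk _) (FreeOperadExpr.mapGen_mapGen φ.apply_symm_apply x) }
  equiv_map := by rintro A B _ _ e ⟨x⟩; rfl
  equiv_one := rfl
  equiv_comp := by rintro A B _ _ ⟨x⟩ ⟨y⟩; rfl

/-- The map `F(V)(3) → F(W)(3)` induced by a linear map `f : V → W`. -/
noncomputable def treeMap (f : V →ₗ[K] W) : (Fin 3 → V ⊗[K] V) →ₗ[K] (Fin 3 → W ⊗[K] W) :=
  (TensorProduct.map f f).compLeft (Fin 3)

theorem treeMap_apply (f : V →ₗ[K] W) (t : Fin 3 → V ⊗[K] V) (k : Fin 3) :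
    treeMap f t k = TensorProduct.map f f (t k) := rfl

theorem treeMap_symm_treeMap (φ : V ≃ₗ[K] W) (t : Fin 3 → V ⊗[K] V) :
    treeMap φ.symm.toLinearMap (treeMap φ.toLinearMap t) = t := by
  funext k
  exact (TensorProduct.congr φ φ).symm_apply_apply (t k)

theorem treeMap_treeSwap {τ : V →ₗ[K] V} {τ' : W →ₗ[K] W} {f : V →ₗ[K] W}
    (hf : ∀ v, f (τ v) = τ' (f v)) (t : Fin 3 → V ⊗[K] V) :
    treeMap f (treeSwap τ t) = treeSwap τ' (treeMap f t) := by
  funext k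
  simp only [treeMap_apply, treeSwap, LinearMap.pi_apply, LinearMap.comp_apply,
    LinearMap.proj_apply]
  induction t (-k) with
  | zero => simp
  | add x y hx hy => simp only [map_add, hx, hy]
  | tmul a b => simp [hf]

theorem treeMap_jacobiatorTree (f : V →ₗ[K] W) (b : V) :
    treeMap f (jacobiatorTree b) = jacobiatorTree (K := K) (f b) := rfl

theorem treeMap_associatorTree {τ : V →ₗ[K] V} {τ' : W →ₗ[K] W} {f : V →ₗ[K] W}
    (hf : ∀ v, f (τ v) = τ' (f v)) (a : V) :
    treeMap f (associatorTree τ a) = associatorTree τ' (f a) := by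
  funext k
  fin_cases k <;> simp [treeMap_apply, associatorTree, leftTree, rightTree, hf]

theorem FreeOperad.congr_treeEval {τ : V →ₗ[K] V} {τ' : W →ₗ[K] W} (φ : V ≃ₗ[K] W)
    (hφ : ∀ v, φ (τ v) = τ' (φ v)) (hφ' : ∀ w, φ.symm (τ' w) = τ (φ.symm w))
    (t : Fin 3 → V ⊗[K] V) :
    (FreeOperad.congr φ hφ hφ').equiv (Fin 3) (treeEval τ t)
      = treeEval τ' (treeMap φ.toLinearMap t) := by
  simp only [treeEval, LinearMap.lsum_apply, LinearMap.sum_apply, map_sum, LinearMap.comp_apply,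
    LinearMap.proj_apply, treeMap_apply]
  refine Finset.sum_congr rfl fun k _ => ?_
  induction t k with
  | zero => simp
  | add x y hx hy => simp only [map_add, hx, hy]
  | tmul a b => rfl

end Functoriality

namespace BinaryQuadraticData

variable {K : Type u} [Field K]

/-- An isomorphism of binary quadratic data induces an isomorphism of the operads presented. -/
theorem nonempty_iso_operad (P Q : BinaryQuadraticData K) (φ : P.V ≃ₗ[K] Q.V)
    (hφ : ∀ v, φ (P.τ v) = Q.τ (φ v)) (h : ∀ r ∈ P.R, treeMap φ.toLinearMap r ∈ Q.R)
    (h' : ∀ s ∈ Q.R, treeMap φ.symm.toLinearMap s ∈ P.R) :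
    Nonempty (SymOperad.Iso P.operad Q.operad) := by
  have hφ' : ∀ w, φ.symm (Q.τ w) = P.τ (φ.symm w) := fun w => by
    rw [LinearEquiv.symm_apply_eq, hφ, LinearEquiv.apply_symm_apply]
  let f := FreeOperad.congr φ hφ hφ'
  refine ⟨f.quotient _ _ (SymOperad.Ideal.span_le_comap_span f ?_)
    (SymOperad.Ideal.span_le_comap_span f.symm ?_)⟩
  · rintro _ ⟨r, hr, rfl⟩
    exact ⟨_, h r hr, (FreeOperad.congr_treeEval φ hφ hφ' r).symm⟩
  · rintro _ ⟨s, hs, rfl⟩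
    exact ⟨_, h' s hs, (FreeOperad.congr_treeEval φ.symm hφ' hφ s).symm⟩

/-- The relator `x` generates the `S₃`-module of relators of `P`: it lies in `P.R`, and `P.R` is
contained in every submodule that contains `x` and is stable under `treeCycle` and `treeSwap`,
the actions of generators of `S₃`. -/
structure IsGenerator (P : BinaryQuadraticData K) (x : Fin 3 → P.V ⊗[K] P.V) : Prop where
  mem : x ∈ P.R
  le : ∀ S : Submodule K (Fin 3 → P.V ⊗[K] P.V), x ∈ S → (∀ r ∈ S, treeCycle r ∈ S) →
    (∀ r ∈ S, treeSwap P.τ r ∈ S) → P.R ≤ S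

theorem isGenerator_ofRelators {V : Type u} [AddCommGroup V] [Module K V] (τ : V →ₗ[K] V)
    (hτ : ∀ v, τ (τ v) = v) (x : Fin 3 → V ⊗[K] V) : IsGenerator (ofRelators V τ hτ {x}) x where
  mem := by
    change x ∈ sInf {S : Submodule K (Fin 3 → V ⊗[K] V) |
      {x} ⊆ (S : Set (Fin 3 → V ⊗[K] V)) ∧ (∀ r ∈ S, treeCycle r ∈ S) ∧ ∀ r ∈ S, treeSwap τ r ∈ S}
    exact Submodule.mem_sInf.2 fun _ hS => hS.1 rfl
  le _ hx hc hs := sInf_le ⟨Set.singleton_subset_iff.2 hx, hc, hs⟩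

theorem nonempty_iso_operad_of_isGenerator {P Q : BinaryQuadraticData K}
    {x : Fin 3 → P.V ⊗[K] P.V} {y : Fin 3 → Q.V ⊗[K] Q.V} (hx : P.IsGenerator x)
    (hy : Q.IsGenerator y) (φ : P.V ≃ₗ[K] Q.V) (hφ : ∀ v, φ (P.τ v) = Q.τ (φ v))
    (h : treeMap φ.toLinearMap x = y) : Nonempty (SymOperad.Iso P.operad Q.operad) := by
  have hφ' : ∀ w, φ.symm (Q.τ w) = P.τ (φ.symm w) := fun w => by
    rw [LinearEquiv.symm_apply_eq, hφ, LinearEquiv.apply_symm_apply]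
  refine nonempty_iso_operad P Q φ hφ
    (hx.le (Q.R.comap (treeMap φ.toLinearMap)) ?_ ?_ ?_)
    (hy.le (P.R.comap (treeMap φ.symm.toLinearMap)) ?_ ?_ ?_)
  · rw [Submodule.mem_comap, h]
    exact hy.mem
  · exact fun r hr => Q.treeCycle_mem _ hr
  · intro r hr
    rw [Submodule.mem_comap, treeMap_treeSwap hφ]
    exact Q.treeSwap_mem _ hr
  · rw [Submodule.mem_comap, ← h, treeMap_symm_treeMap]
    exact hx.mem
  · exact fun r hr => P.treeCycle_mem _ hr
  · intro r hr
    rw [Submodule.mem_comap, treeMap_treeSwap (f := φ.symm.toLinearMap) hφ']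
    exact P.treeSwap_mem _ hr

/-! ### Relators of a black product -/

section Black

variable {V W : Type u} [AddCommGroup V] [Module K V] [AddCommGroup W] [Module K W]

/-- The map `Ψ` with its second argument fixed, as a linear map of the first one. -/
noncomputable def blackMapLeft (s : Fin 3 → W ⊗[K] W) :
    (Fin 3 → V ⊗[K] V) →ₗ[K] (Fin 3 → (V ⊗[K] W) ⊗[K] (V ⊗[K] W)) where
  toFun r := blackMap r s
  map_add' r r' := by funext k; simp [blackMap, TensorProduct.add_tmul]
  map_smul' c r := by
    funext k
    simp only [blackMap, Pi.smul_apply, ← TensorProduct.smul_tmul', map_smul, RingHom.id_apply]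

theorem blackMap_smul (r : Fin 3 → V ⊗[K] V) (c : K) (s : Fin 3 → W ⊗[K] W) :
    blackMap r (c • s) = c • blackMap r s := by
  funext k
  simp [blackMap]

theorem blackMap_neg (r : Fin 3 → V ⊗[K] V) (s : Fin 3 → W ⊗[K] W) :
    blackMap r (-s) = -blackMap r s := by
  funext k
  simp [blackMap, TensorProduct.tmul_neg]

theorem blackMap_jacobiatorTree (a : V) (b : W) :
    blackMap (jacobiatorTree (K := K) a) (jacobiatorTree b) = jacobiatorTree (a ⊗ₜ[K] b) := by
  funext k
  simp [blackMap, jacobiatorTree]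

theorem blackMap_associatorTree_jacobiatorTree (τ : V →ₗ[K] V) (τ' : W →ₗ[K] W) (a : V) {b : W}
    (hb : τ' b = -b) :
    blackMap (associatorTree τ a) (jacobiatorTree b)
      = associatorTree (blackSwap τ τ') (a ⊗ₜ[K] b) := by
  funext k
  fin_cases k <;>
    simp [blackMap, jacobiatorTree, associatorTree, leftTree, rightTree, blackSwap, hb,
      TensorProduct.tmul_neg, TensorProduct.neg_tmul]

end Black

/-- `S₃` acts by the sign on the Jacobiator of an antisymmetric operation. -/
theorem treeSwap_jacobiatorTree {V : Type u} [AddCommGroup V] [Module K V] {τ : V →ₗ[K] V}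
    {b : V} (hb : τ b = -b) : treeSwap τ (jacobiatorTree b) = -jacobiatorTree b := by
  funext k
  simp [treeSwap, jacobiatorTree, hb, TensorProduct.tmul_neg]

/-- The line through the Jacobiator of an antisymmetric operation is stable under `S₃`, so it is
all of the relators that the Jacobiator generates. -/
theorem IsGenerator.eq_span {Q : BinaryQuadraticData K} {b : Q.V} (hb : Q.τ b = -b)
    (hQ : Q.IsGenerator (jacobiatorTree b)) : Q.R = Submodule.span K {jacobiatorTree b} := by
  refine le_antisymm (hQ.le _ (Submodule.mem_span_singleton_self _) ?_ ?_)
    ((Submodule.span_singleton_le_iff_mem _ _).2 hQ.mem)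
  · intro r hr
    obtain ⟨c, rfl⟩ := Submodule.mem_span_singleton.1 hr
    exact hr
  · intro r hr
    obtain ⟨c, rfl⟩ := Submodule.mem_span_singleton.1 hr
    rw [map_smul, treeSwap_jacobiatorTree hb, smul_neg]
    exact Submodule.neg_mem _ hr

/-- If the Jacobiator `j` of an antisymmetric operation generates the relators of `Q`, then
`r ↦ Ψ (r ⊗ j)` preserves generators of relators: the sign twist of the black product cancels the
sign by which `S₃` acts on `j`. -/
theorem IsGenerator.black {P Q : BinaryQuadraticData K} {x : Fin 3 → P.V ⊗[K] P.V}
    (hx : P.IsGenerator x) {b : Q.V} (hb : Q.τ b = -b) (hQ : Q.IsGenerator (jacobiatorTree b)) :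
    IsGenerator (P.black Q) (blackMap x (jacobiatorTree b)) where
  mem := by
    change blackMap x (jacobiatorTree b) ∈
      Submodule.span K {t | ∃ r ∈ P.R, ∃ s ∈ Q.R, t = blackMap r s}
    exact Submodule.subset_span ⟨x, hx.mem, jacobiatorTree b, hQ.mem, rfl⟩
  le := by
    change ∀ S : Submodule K (Fin 3 → (P.V ⊗[K] Q.V) ⊗[K] (P.V ⊗[K] Q.V)),
      blackMap x (jacobiatorTree b) ∈ S → (∀ t ∈ S, treeCycle t ∈ S) →
      (∀ t ∈ S, treeSwap (blackSwap P.τ Q.τ) t ∈ S) →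
      Submodule.span K {t | ∃ r ∈ P.R, ∃ s ∈ Q.R, t = blackMap r s} ≤ S
    intro S hS hc hs
    have key : P.R ≤ S.comap (blackMapLeft (jacobiatorTree b)) := by
      refine hx.le _ hS (fun r hr => ?_) (fun r hr => ?_)
      · have h := hc _ hr
        change treeCycle (blackMap r (jacobiatorTree b)) ∈ S at h
        rw [treeCycle_blackMap] at h
        -- the Jacobiator is fixed by `treeCycle`, by definition
        exact h
      · have h := hs _ hr
        change treeSwap (blackSwap P.τ Q.τ) (blackMap r (jacobiatorTree b)) ∈ S at h
        rwa [treeSwap_blackMap, treeSwap_jacobiatorTree hb, blackMap_neg, neg_neg] at h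
    refine Submodule.span_le.2 ?_
    rintro _ ⟨r, hr, s, hs, rfl⟩
    rw [hQ.eq_span hb] at hs
    obtain ⟨c, rfl⟩ := Submodule.mem_span_singleton.1 hs
    rw [blackMap_smul]
    exact S.smul_mem c (key hr)

/-! ### Lie-admissible algebras -/

variable (K)

/-- The bracket `a ∘ b - b ∘ a` of the operad of Lie-admissible algebras. -/
def bracket : K × K := (1, 0) - regSwap K (1, 0)

theorem bracket_eq : bracket K = (1, -1) := by simp [bracket, regSwap]

theorem regSwap_bracket : regSwap K (bracket K) = -bracket K := by
  simp [bracket_eq, regSwap]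

theorem isGenerator_LieAdm :
    IsGenerator (LieAdm K) (jacobiatorTree (V := (LieAdm K).V) (bracket K)) :=
  isGenerator_ofRelators _ _ _

variable {K} in
theorem IsGenerator.black_LieAdm {P : BinaryQuadraticData K} {x : Fin 3 → P.V ⊗[K] P.V}
    (hx : P.IsGenerator x) : IsGenerator (P.black (LieAdm K))
      (blackMap x (jacobiatorTree (V := (LieAdm K).V) (bracket K))) :=
  hx.black (regSwap_bracket K) (isGenerator_LieAdm K)

/-! ### Identification of the generators -/

/-- The identification `(x, y) ↦ 1 ⊗ (x, -y)` of the generators of `ComAdm` and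
`Com • LieAdm`. -/
noncomputable def comEquiv : (K × K) ≃ₗ[K] K ⊗[K] (K × K) :=
  ((LinearEquiv.refl K K).prodCongr (LinearEquiv.neg K)).trans (TensorProduct.lid K (K × K)).symm

theorem comEquiv_apply (x y : K) : comEquiv K (x, y) = 1 ⊗ₜ (x, -y) := rfl

/-- The identification of the generators of `AssAdm` and `Ass • LieAdm` that takes `≻` to `a ⊗ μ`
and `≺` to `-a ⊗ τ μ`, where `a` and `μ` are the generators of `Ass` and `LieAdm`. The
values on the opposite operations are forced by equivariance. -/
noncomputable def assEquiv : ((K × K) × (K × K)) ≃ₗ[K] (K × K) ⊗[K] (K × K) :=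
  LinearEquiv.trans
    { toFun := fun v => ((v.1.1, -v.2.1), (v.2.2, -v.1.2))
      invFun := fun v => ((v.1.1, -v.2.2), (-v.1.2, v.2.1))
      map_add' := fun v v' => by simp [add_comm]
      map_smul' := fun c v => by simp
      left_inv := fun v => by simp
      right_inv := fun v => by simp }
    (((TensorProduct.lid K (K × K)).symm.prodCongr (TensorProduct.lid K (K × K)).symm).trans
      (TensorProduct.prodLeft K K K K (K × K)).symm)

theorem assEquiv_apply (x y z w : K) :
    assEquiv K ((x, y), (z, w)) = (1, 0) ⊗ₜ (x, -z) + (0, 1) ⊗ₜ (w, -y) := by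
  change (TensorProduct.prodLeft K K K K (K × K)).symm (1 ⊗ₜ (x, -z), 1 ⊗ₜ (w, -y)) = _
  rw [LinearEquiv.symm_apply_eq]
  simp

end BinaryQuadraticData

open BinaryQuadraticData in
theorem mainTheorem6 (K : Type u) [Field K] [CharZero K] :
    Nonempty (SymOperad.Iso (BinaryQuadraticData.LieAdm K).operad
      ((BinaryQuadraticData.Lie K).black (BinaryQuadraticData.LieAdm K)).operad) ∧
    Nonempty (SymOperad.Iso (BinaryQuadraticData.AssAdm K).operad
      ((BinaryQuadraticData.Ass K).black (BinaryQuadraticData.LieAdm K)).operad) ∧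
    Nonempty (SymOperad.Iso (BinaryQuadraticData.ComAdm K).operad
      ((BinaryQuadraticData.Com K).black (BinaryQuadraticData.LieAdm K)).operad) := by
  refine ⟨?_, ?_, ?_⟩
  · have h : ∀ v, (TensorProduct.lid K (K × K)).symm (regSwap K v)
        = blackSwap (-LinearMap.id) (regSwap K) ((TensorProduct.lid K (K × K)).symm v) := by
      intro v
      simp [blackSwap, TensorProduct.neg_tmul]
    have hx : treeMap (TensorProduct.lid K (K × K)).symm.toLinearMap (jacobiatorTree (bracket K))
        = blackMap (jacobiatorTree 1) (jacobiatorTree (bracket K)) := by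
      rw [treeMap_jacobiatorTree, blackMap_jacobiatorTree]
      rfl
    exact nonempty_iso_operad_of_isGenerator (isGenerator_ofRelators _ _ _)
      (isGenerator_ofRelators _ _ _).black_LieAdm (TensorProduct.lid K (K × K)).symm h hx
  · have h : ∀ v, assEquiv K ((regSwap K).prodMap (regSwap K) v)
        = blackSwap (regSwap K) (regSwap K) (assEquiv K v) := by
      rintro ⟨⟨x, y⟩, ⟨z, w⟩⟩
      have h1 : (-z, x) = -((z, -x) : K × K) := by simp
      have h2 : (-y, w) = -((y, -w) : K × K) := by simp
      simp only [regSwap, LinearMap.prodMap_apply, LinearEquiv.coe_coe,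
        LinearEquiv.prodComm_apply, Prod.swap_prod_mk, assEquiv_apply, blackSwap,
        LinearMap.neg_apply, map_add, TensorProduct.map_tmul, h1, h2, TensorProduct.tmul_neg]
      abel
    have hx : treeMap (assEquiv K).toLinearMap
          (associatorTree ((regSwap K).prodMap (regSwap K)) (((1, 0), 0) + (0, (1, 0))))
        = blackMap (associatorTree (regSwap K) (1, 0)) (jacobiatorTree (bracket K)) := by
      rw [blackMap_associatorTree_jacobiatorTree _ _ _ (regSwap_bracket K)]
      refine (treeMap_associatorTree h _).trans (congrArg _ ?_)
      have h0 : (0 : K × K) = (0, 0) := rfl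
      simp only [Prod.mk_add_mk, add_zero, zero_add, LinearEquiv.coe_coe, assEquiv_apply,
        bracket_eq, neg_zero, ← h0, TensorProduct.tmul_zero]
    exact nonempty_iso_operad_of_isGenerator (isGenerator_ofRelators _ _ _)
      (isGenerator_ofRelators _ _ _).black_LieAdm (assEquiv K) h hx
  · have h : ∀ v, comEquiv K (regSwap K v)
        = blackSwap LinearMap.id (regSwap K) (comEquiv K v) := by
      rintro ⟨x, y⟩
      have h1 : (-y, x) = -((y, -x) : K × K) := by simp
      simp only [regSwap, LinearEquiv.coe_coe, LinearEquiv.prodComm_apply, Prod.swap_prod_mk,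
        comEquiv_apply, blackSwap, LinearMap.neg_apply, TensorProduct.map_tmul, h1,
        TensorProduct.tmul_neg, LinearMap.id_apply, neg_neg]
    have hx : treeMap (comEquiv K).toLinearMap
          (associatorTree (regSwap K) ((1, 0) + regSwap K (1, 0)))
        = blackMap (associatorTree LinearMap.id 1) (jacobiatorTree (bracket K)) := by
      rw [blackMap_associatorTree_jacobiatorTree _ _ _ (regSwap_bracket K)]
      refine (treeMap_associatorTree h _).trans (congrArg _ ?_)
      simp [comEquiv_apply, bracket_eq, regSwap]
    exact nonempty_iso_operad_of_isGenerator (isGenerator_ofRelators _ _ _)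
      (isGenerator_ofRelators _ _ _).black_LieAdm (comEquiv K) h hx
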